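/- Let $E = (E^0, E^1, r, s)$ be a topological graph: $E^0$ and $E^1$ are locally compact Hausdorff spaces, $r : E^1 \to E^0$ is continuous, and $s : E^1 \to E^0$ is a local homeomorphism. Let $H(E)$ be the completion of $C_c(E^1)$ with respect to the $C_0(E^0)$-valued inner product $\langle \xi, \eta\rangle(v) = \sum_{s(e) = v} \overline{\xi(e)}\,\eta(e)$, with actions $a \cdot \xi = (a \circ r)\xi$ and $\xi \cdot a = \xi (a \circ s)$ of $C_0(E^0)$. Let $\mathcal{K}(H(E))$ be the closed linear span of the operators $\xi \otimes \eta^* : \zeta \mapsto \xi \cdot \langle \eta, \zeta\rangle$, let $\lambda$ be the action of bounded continuous functions on $E^1$ on $H(E)$ by multiplication, and let $E^0_{\mathrm{reg}} \subseteq E^0$ be the largest open set such that $r$ restricts to a proper surjection $r^{-1}(E^0_{\mathrm{reg}}) \to E^0_{\mathrm{reg}}$. A covariant representation of $E$ on a $C^*$-algebra $A$ is a pair of a $*$-homomorphism $\pi^0 : C_0(E^0) \to A$ and a linear map $\pi^1 : H(E) \to A$ with $\pi^1(\xi)^*\pi^1(\eta) = \pi^0(\langle \xi, \eta\rangle)$,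 $\pi^0(a)\pi^1(\xi) = \pi^1(a \cdot \xi)$, and $\varphi(\lambda(a \circ r)) = \pi^0(a)$ for all $a \in C_0(E^0_{\mathrm{reg}})$, where $\varphi : \mathcal{K}(H(E)) \to A$ is the $*$-homomorphism with $\varphi(\xi \otimes \eta^*) = \pi^1(\xi)\pi^1(\eta)^*$. Let $C^*(E)$ be the universal $C^*$-algebra generated by a covariant representation $(\pi^0, \pi^1)$ of $E$, and let $\gamma$ be its gauge action, i.e. the action of the circle $\mathbb{T}$ on $C^*(E)$ with $\gamma_z(\pi^0(a)) = \pi^0(a)$ and $\gamma_z(\pi^1(\xi)) = z\,\pi^1(\xi)$. Suppose that $E$ has no cycles, i.e. there are no $n \ge 1$ and edges $\alpha_1, \ldots, \alpha_n \in E^1$ with $s(\alpha_i) = r(\alpha_{i+1})$ for $1 \le i < n$ and $s(\alpha_n) = r(\alpha_1)$. Then every tracial state $\tau$ on $C^*(E)$ (a positive linear functional of norm one with $\tau(xy) = \tau(yx)$ for all $x, y$) is gauge invariant: $\tau(\gamma_z(x)) = \tau(x)$ for all $z \in \mathbb{T}$ and $x \in C^*(E)$. -/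

import Mathlib

universe u v

noncomputable section

set_option linter.unusedSectionVars false

open scoped ZeroAtInfty CompactlySupported BoundedContinuousFunction ENNReal ComplexOrder Topology

/-- A topological graph: locally compact Hausdorff spaces `V` (vertices) and `W` (edges), a continuous
range map `r : W → V` and a source map `s : W → V` which is a local homeomorphism. -/
structure TopologicalGraph (V : Type u) (W : Type v)
    [TopologicalSpace V] [LocallyCompactSpace V] [T2Space V]
    [TopologicalSpace W] [LocallyCompactSpace W] [T2Space W] where
  r : W → V
  s : W → V
  continuous_r : Continuous r
  isLocalHomeomorph_s : IsLocalHomeomorph s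

namespace TopologicalGraph

variable {V : Type u} {W : Type v}
  [TopologicalSpace V] [LocallyCompactSpace V] [T2Space V]
  [TopologicalSpace W] [LocallyCompactSpace W] [T2Space W]

/-- A path `α₁ ⋯ αₙ` of length `n ≥ 1` (edges with `s αᵢ = r αᵢ₊₁`) which is a cycle, i.e. `s αₙ = r α₁`. -/
def IsCycle (E : TopologicalGraph V W) (l : List W) : Prop :=
  l.IsChain (fun e f => E.s e = E.r f) ∧
    ∃ h : l ≠ [], E.s (l.getLast h) = E.r (l.head h)

/-- The set of regular vertices: the largest open set `U` of vertices such that `r` restricts to a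
proper surjection `r⁻¹(U) → U`. -/
def regularVertices (E : TopologicalGraph V W) : Set V :=
  ⋃₀ {U : Set V | IsOpen U ∧ IsProperMap (U.restrictPreimage E.r) ∧ U ⊆ Set.range E.r}

section FiberSum

/-- The sum `v ↦ ∑_{s(e) = v} f(e)` over the fibres of the source map. -/
def fiberSum (E : TopologicalGraph V W) (f : W → ℂ) (v : V) : ℂ :=
  ∑ᶠ e ∈ E.s ⁻¹' {v}, f e

variable (E : TopologicalGraph V W)

theorem finite_fiber {K : Set W} (hK : IsCompact K) (v : V) : (E.s ⁻¹' {v} ∩ K).Finite := by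
  have hc : IsCompact (E.s ⁻¹' {v} ∩ K) :=
    hK.inter_left (isClosed_singleton.preimage E.isLocalHomeomorph_s.continuous)
  refine hc.finite ?_
  refine (E.isLocalHomeomorph_s.isLocalHomeomorphOn (s := _)).isDiscrete_of_image ?_
  refine Set.Subsingleton.isDiscrete ?_
  rintro _ ⟨x, hx, rfl⟩ _ ⟨y, hy, rfl⟩
  rw [show E.s x = v from hx.1, show E.s y = v from hy.1]

theorem finite_support {f : W → ℂ} (hf : HasCompactSupport f) (v : V) :
    (E.s ⁻¹' {v} ∩ Function.support f).Finite :=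
  (E.finite_fiber hf v).subset (Set.inter_subset_inter_right _ (subset_tsupport f))

theorem continuous_fiberSum {f : W → ℂ} (hc : Continuous f) (hf : HasCompactSupport f) :
    Continuous (E.fiberSum f) := by
  classical
  rw [continuous_iff_continuousAt]
  intro v₀
  have hfin := E.finite_fiber hf v₀
  obtain ⟨U, hU, hdisj⟩ := hfin.t2_separation
  choose g hg hgs using E.isLocalHomeomorph_s
  set F := hfin.toFinset with hF
  have hFs : ∀ x ∈ F, E.s x = v₀ := fun x hx => ((hfin.mem_toFinset).1 hx).1
  let U' : W → Set W := fun x => U x ∩ (g x).source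
  have hU'o : ∀ x, IsOpen (U' x) := fun x => (hU x).2.inter (g x).open_source
  have hxU' : ∀ x, x ∈ U' x := fun x => ⟨(hU x).1, hg x⟩
  let N : Set V := (⋂ x ∈ F, E.s '' U' x) ∩ (E.s '' (tsupport f \ ⋃ x ∈ F, U' x))ᶜ
  have hN : N ∈ 𝓝 v₀ := by
    refine Filter.inter_mem ?_ ?_
    · refine (Filter.biInter_finset_mem F).2 fun x hx => ?_
      refine (E.isLocalHomeomorph_s.isOpenMap _ (hU'o x)).mem_nhds ⟨x, hxU' x, hFs x hx⟩
    · have hcl : IsClosed (E.s '' (tsupport f \ ⋃ x ∈ F, U' x)) := by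
        refine IsCompact.isClosed (IsCompact.image ?_ E.isLocalHomeomorph_s.continuous)
        exact IsCompact.diff hf (isOpen_biUnion fun x _ => hU'o x)
      refine hcl.isOpen_compl.mem_nhds ?_
      rintro ⟨x, ⟨hx1, hx2⟩, hx3⟩
      refine hx2 (Set.mem_biUnion (x := x) ?_ (hxU' x))
      exact (hfin.mem_toFinset).2 ⟨hx3, hx1⟩
  have key : ∀ v ∈ N, E.fiberSum f v = ∑ x ∈ F, f ((g x).symm v) := by
    intro v hv
    have h1 : ∀ x ∈ F, (g x).symm v ∈ U' x ∧ E.s ((g x).symm v) = v := by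
      intro x hx
      obtain ⟨y, hy, rfl⟩ := Set.mem_iInter₂.1 hv.1 x hx
      have : (g x).symm (E.s y) = y := by
        conv_lhs => rw [hgs x]
        exact (g x).left_inv hy.2
      rw [this]; exact ⟨hy, rfl⟩
    have hinj : Set.InjOn (fun x => (g x).symm v) F := by
      intro x hx y hy hxy
      by_contra hne
      refine Set.disjoint_left.1 (hdisj ((hfin.mem_toFinset).1 hx) ((hfin.mem_toFinset).1 hy) hne)
        (h1 x hx).1.1 ?_
      have := (h1 y hy).1.1
      simp only at hxy
      rwa [← hxy] at this
    rw [fiberSum, ← Finset.sum_image (f := f) hinj]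
    refine finsum_mem_eq_sum_of_inter_support_eq f ?_
    ext y
    simp only [Set.mem_inter_iff, Set.mem_preimage, Set.mem_singleton_iff, Finset.coe_image,
      Set.mem_image, Finset.mem_coe]
    constructor
    · rintro ⟨hy, hy'⟩
      refine ⟨?_, hy'⟩
      by_contra hcon
      refine hv.2 ⟨y, ⟨subset_tsupport f hy', ?_⟩, hy⟩
      intro hmem
      obtain ⟨x, hx, hyx⟩ := Set.mem_iUnion₂.1 hmem
      refine hcon ⟨x, hx, ?_⟩
      rw [← hy]
      conv_lhs => rw [hgs x]
      exact (g x).left_inv hyx.2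
    · rintro ⟨⟨x, hx, rfl⟩, hy'⟩
      exact ⟨(h1 x hx).2, hy'⟩
  have hcont : ContinuousAt (fun v => ∑ x ∈ F, f ((g x).symm v)) v₀ := by
    refine tendsto_finsetSum _ fun x hx => ?_
    refine (hc.continuousAt (x := (g x).symm v₀)).comp ?_
    refine (g x).continuousAt_symm ?_
    rw [← hFs x hx, hgs x]
    exact (g x).map_source (hg x)
  exact hcont.congr (Filter.eventually_of_mem hN fun v hv => (key v hv).symm)

theorem hasCompactSupport_fiberSum {f : W → ℂ} (hf : HasCompactSupport f) :
    HasCompactSupport (E.fiberSum f) := by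
  refine HasCompactSupport.intro (IsCompact.image hf E.isLocalHomeomorph_s.continuous) ?_
  intro v hv
  refine finsum_mem_eq_zero_of_forall_eq_zero fun e he => ?_
  by_contra hne
  exact hv ⟨e, subset_tsupport f hne, he⟩

/-- The fibre sum of a compactly supported continuous function, as an element of `C₀(V)`. -/
def fiberSum₀ (f : C_c(W, ℂ)) : C₀(V, ℂ) where
  toFun := E.fiberSum f
  continuous_toFun := E.continuous_fiberSum f.continuous f.hasCompactSupport
  zero_at_infty' := (E.hasCompactSupport_fiberSum f.hasCompactSupport).is_zero_at_infty

theorem fiberSum_add {f g : W → ℂ} (hf : HasCompactSupport f) (hg : HasCompactSupport g) (v : V) :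
    E.fiberSum (f + g) v = E.fiberSum f v + E.fiberSum g v :=
  finsum_mem_add_distrib' (E.finite_support hf v) (E.finite_support hg v)

theorem fiberSum_eq_sum {f : W → ℂ} (v : V) {t : Finset W}
    (h : ∀ e, E.s e = v → f e ≠ 0 → e ∈ t) (h' : ∀ e ∈ t, E.s e = v) :
    E.fiberSum f v = ∑ e ∈ t, f e := by
  refine finsum_mem_eq_sum_of_inter_support_eq f ?_
  ext e
  simp only [Set.mem_inter_iff, Set.mem_preimage, Set.mem_singleton_iff, Finset.mem_coe,
    Function.mem_support]
  exact ⟨fun h1 => ⟨h e h1.1 h1.2, h1.2⟩, fun h1 => ⟨h' e h1.1, h1.2⟩⟩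

theorem fiberSum_eq_sum_support {f g : W → ℂ} (hf : HasCompactSupport f)
    (hg : ∀ e, f e = 0 → g e = 0) (v : V) :
    E.fiberSum g v = ∑ e ∈ (E.finite_support hf v).toFinset, g e := by
  refine E.fiberSum_eq_sum v (fun e he hge => ?_) (fun e he => ?_)
  · exact (Set.Finite.mem_toFinset _).2 ⟨he, fun h => hge (hg e h)⟩
  · exact ((Set.Finite.mem_toFinset _).1 he).1

theorem fiberSum_const_mul (c : ℂ) {f : W → ℂ} (hf : HasCompactSupport f) (v : V) :
    E.fiberSum (fun e => c * f e) v = c * E.fiberSum f v := by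
  rw [E.fiberSum_eq_sum_support hf (fun e he => by simp [he]),
    E.fiberSum_eq_sum_support hf (fun e he => he), Finset.mul_sum]

end FiberSum

section HilbertModule

/-- The space `C_c(W)` of compactly supported continuous functions on the edges of `E`, to be
equipped with the norm `‖ξ‖ = ‖⟨ξ, ξ⟩‖ ^ (1/2)` coming from its `C₀(V)`-valued inner product. -/
def EdgeFun (_E : TopologicalGraph V W) : Type v := C_c(W, ℂ)

variable (E : TopologicalGraph V W)

instance : AddCommGroup E.EdgeFun := inferInstanceAs (AddCommGroup C_c(W, ℂ))
instance : Module ℂ E.EdgeFun := inferInstanceAs (Module ℂ C_c(W, ℂ))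
instance : FunLike E.EdgeFun W ℂ := inferInstanceAs (FunLike C_c(W, ℂ) W ℂ)

/-- The inner product `⟨ξ, η⟩(v) = ∑_{s(e) = v} conj (ξ(e)) η(e)` on `C_c(W)`. -/
def edgeInner (ξ η : E.EdgeFun) : C₀(V, ℂ) :=
  E.fiberSum₀ (star (show C_c(W, ℂ) from ξ) * (show C_c(W, ℂ) from η))

variable {E}

theorem EdgeFun.hasCompactSupport (ξ : E.EdgeFun) : HasCompactSupport ξ :=
  CompactlySupportedContinuousMap.hasCompactSupport (show C_c(W, ℂ) from ξ)

theorem EdgeFun.continuous (ξ : E.EdgeFun) : Continuous ξ :=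
  (show C_c(W, ℂ) from ξ).continuous

@[ext] theorem EdgeFun.ext {ξ η : E.EdgeFun} (h : ∀ e, ξ e = η e) : ξ = η := DFunLike.ext _ _ h

@[simp] theorem EdgeFun.add_apply (ξ η : E.EdgeFun) (e : W) : (ξ + η) e = ξ e + η e := rfl
@[simp] theorem EdgeFun.smul_apply (c : ℂ) (ξ : E.EdgeFun) (e : W) : (c • ξ) e = c * ξ e := rfl
@[simp] theorem EdgeFun.zero_apply (e : W) : (0 : E.EdgeFun) e = 0 := rfl

theorem edgeInner_apply (ξ η : E.EdgeFun) (v : V) :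
    E.edgeInner ξ η v = E.fiberSum (fun e => star (ξ e) * η e) v := rfl

theorem edgeInner_eq_sum (ξ η : E.EdgeFun) {ζ : E.EdgeFun} (h : ∀ e, ζ e = 0 → ξ e = 0 ∨ η e = 0)
    (v : V) :
    E.edgeInner ξ η v
      = ∑ e ∈ (E.finite_support ζ.hasCompactSupport v).toFinset, star (ξ e) * η e := by
  rw [edgeInner_apply]
  refine E.fiberSum_eq_sum_support ζ.hasCompactSupport (fun e he => ?_) v
  rcases h e he with h | h <;> simp [h]

theorem edgeInner_add_right (ξ η ζ : E.EdgeFun) :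
    E.edgeInner ξ (η + ζ) = E.edgeInner ξ η + E.edgeInner ξ ζ := by
  ext v
  rw [ZeroAtInftyContinuousMap.add_apply]
  simp only [edgeInner_eq_sum (ζ := ξ) ξ _ (fun e he => Or.inl he), EdgeFun.add_apply, mul_add,
    Finset.sum_add_distrib]

theorem edgeInner_smul_right (c : ℂ) (ξ η : E.EdgeFun) :
    E.edgeInner ξ (c • η) = c • E.edgeInner ξ η := by
  ext v
  rw [ZeroAtInftyContinuousMap.smul_apply]
  simp only [edgeInner_eq_sum (ζ := ξ) ξ _ (fun e he => Or.inl he), EdgeFun.smul_apply,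
    smul_eq_mul, Finset.mul_sum]
  exact Finset.sum_congr rfl fun _ _ => by ring

theorem star_edgeInner (ξ η : E.EdgeFun) : star (E.edgeInner ξ η) = E.edgeInner η ξ := by
  ext v
  rw [ZeroAtInftyContinuousMap.star_apply, edgeInner_eq_sum (ζ := ξ) ξ η (fun e he => Or.inl he),
    edgeInner_eq_sum (ζ := ξ) η ξ (fun e he => Or.inr he), star_sum]
  exact Finset.sum_congr rfl fun _ _ => by simp [mul_comm]

theorem edgeInner_add_left (ξ η ζ : E.EdgeFun) :
    E.edgeInner (ξ + η) ζ = E.edgeInner ξ ζ + E.edgeInner η ζ := by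
  rw [← star_edgeInner, edgeInner_add_right, star_add, star_edgeInner, star_edgeInner]

theorem edgeInner_smul_left (c : ℂ) (ξ η : E.EdgeFun) :
    E.edgeInner (c • ξ) η = star c • E.edgeInner ξ η := by
  rw [← star_edgeInner, edgeInner_smul_right, star_smul, star_edgeInner]

theorem edgeInner_self_apply (ξ : E.EdgeFun) (v : V) :
    E.edgeInner ξ ξ v
      = ((∑ e ∈ (E.finite_support ξ.hasCompactSupport v).toFinset, ‖ξ e‖ ^ 2 : ℝ) : ℂ) := by
  rw [edgeInner_eq_sum (ζ := ξ) ξ ξ (fun e he => Or.inl he)]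
  push_cast
  exact Finset.sum_congr rfl fun e _ => by
    rw [← Complex.conj_mul']; rfl

instance : Norm E.EdgeFun := ⟨fun ξ => Real.sqrt ‖E.edgeInner ξ ξ‖⟩

theorem EdgeFun.norm_def (ξ : E.EdgeFun) : ‖ξ‖ = Real.sqrt ‖E.edgeInner ξ ξ‖ := rfl

theorem EdgeFun.norm_sq (ξ : E.EdgeFun) : ‖ξ‖ ^ 2 = ‖E.edgeInner ξ ξ‖ :=
  Real.sq_sqrt (norm_nonneg _)

theorem norm_apply_le_norm (a : C₀(V, ℂ)) (v : V) : ‖a v‖ ≤ ‖a‖ := by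
  rw [← ZeroAtInftyContinuousMap.norm_toBCF_eq_norm]
  exact a.toBCF.norm_coe_le_norm v

theorem norm_le_of_apply {a : C₀(V, ℂ)} {C : ℝ} (hC : 0 ≤ C) (h : ∀ v, ‖a v‖ ≤ C) : ‖a‖ ≤ C := by
  rw [← ZeroAtInftyContinuousMap.norm_toBCF_eq_norm]
  exact (BoundedContinuousFunction.norm_le hC).2 h

theorem sum_le_norm_sq (ξ : E.EdgeFun) (v : V) :
    ∑ e ∈ (E.finite_support ξ.hasCompactSupport v).toFinset, ‖ξ e‖ ^ 2 ≤ ‖ξ‖ ^ 2 := by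
  have h := norm_apply_le_norm (E.edgeInner ξ ξ) v
  rw [edgeInner_self_apply, Complex.norm_real, ← EdgeFun.norm_sq] at h
  exact (le_abs_self _).trans h

/-- The Cauchy–Schwarz inequality. -/
theorem norm_edgeInner_le (ξ η : E.EdgeFun) : ‖E.edgeInner ξ η‖ ≤ ‖ξ‖ * ‖η‖ := by
  refine norm_le_of_apply (mul_nonneg (Real.sqrt_nonneg _) (Real.sqrt_nonneg _)) fun v => ?_
  classical
  set t := (E.finite_support ξ.hasCompactSupport v).toFinset
  set t' := (E.finite_support η.hasCompactSupport v).toFinset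
  have h0 : E.edgeInner ξ η v = ∑ e ∈ t ∩ t', star (ξ e) * η e := by
    rw [edgeInner_apply]
    refine E.fiberSum_eq_sum v (fun e he hne => ?_) (fun e he => ?_)
    · rw [Finset.mem_inter, Set.Finite.mem_toFinset, Set.Finite.mem_toFinset]
      exact ⟨⟨he, fun h => hne (by simp [h])⟩, ⟨he, fun h => hne (by simp [h])⟩⟩
    · exact ((Set.Finite.mem_toFinset _).1 (Finset.mem_inter.1 he).1).1
  rw [h0]
  have h1 : ‖∑ e ∈ t ∩ t', star (ξ e) * η e‖ ≤ ∑ e ∈ t ∩ t', ‖ξ e‖ * ‖η e‖ :=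
    (norm_sum_le _ _).trans (Finset.sum_le_sum fun e _ => by simp)
  refine h1.trans (abs_le_of_sq_le_sq' ?_ (mul_nonneg (Real.sqrt_nonneg _) (Real.sqrt_nonneg _))).2
  refine (Finset.sum_mul_sq_le_sq_mul_sq _ _ _).trans ?_
  rw [mul_pow]
  refine mul_le_mul ?_ ?_ (Finset.sum_nonneg fun _ _ => sq_nonneg _) (sq_nonneg _)
  · exact (Finset.sum_le_sum_of_subset_of_nonneg Finset.inter_subset_left
      fun _ _ _ => sq_nonneg _).trans (sum_le_norm_sq ξ v)
  · exact (Finset.sum_le_sum_of_subset_of_nonneg Finset.inter_subset_right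
      fun _ _ _ => sq_nonneg _).trans (sum_le_norm_sq η v)

theorem EdgeFun.normedSpaceCore : NormedSpace.Core ℂ E.EdgeFun where
  norm_nonneg ξ := Real.sqrt_nonneg _
  norm_smul c ξ := by
    rw [EdgeFun.norm_def, edgeInner_smul_left, edgeInner_smul_right, norm_smul, norm_smul,
      norm_star, ← mul_assoc, Real.sqrt_mul (by positivity), Real.sqrt_mul_self (norm_nonneg _),
      ← EdgeFun.norm_def]
  norm_triangle ξ η := by
    refine (abs_le_of_sq_le_sq' ?_ (add_nonneg (Real.sqrt_nonneg _) (Real.sqrt_nonneg _))).2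
    change _ ≤ (‖ξ‖ + ‖η‖) ^ 2
    rw [EdgeFun.norm_sq, edgeInner_add_left, edgeInner_add_right, edgeInner_add_right]
    have h1 := norm_edgeInner_le ξ η
    have h2 := norm_edgeInner_le η ξ
    have h3 := norm_add_le (E.edgeInner ξ ξ + E.edgeInner ξ η)
      (E.edgeInner η ξ + E.edgeInner η η)
    have h4 := norm_add_le (E.edgeInner ξ ξ) (E.edgeInner ξ η)
    have h5 := norm_add_le (E.edgeInner η ξ) (E.edgeInner η η)
    have h6 := EdgeFun.norm_sq ξ
    have h7 := EdgeFun.norm_sq η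
    nlinarith
  norm_eq_zero_iff ξ := by
    constructor
    · intro h
      ext e
      by_contra hne
      have h1 := sum_le_norm_sq ξ (E.s e)
      rw [h] at h1
      have h2 : ‖ξ e‖ ^ 2 ≤ ∑ e ∈ (E.finite_support ξ.hasCompactSupport (E.s e)).toFinset,
          ‖ξ e‖ ^ 2 :=
        Finset.single_le_sum (f := fun e => ‖ξ e‖ ^ 2) (fun _ _ => sq_nonneg _)
          ((Set.Finite.mem_toFinset _).2 ⟨rfl, hne⟩)
      have h3 : 0 < ‖ξ e‖ ^ 2 := pow_pos (norm_pos_iff.2 hne) 2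
      simp only [ne_eq, OfNat.ofNat_ne_zero, not_false_eq_true, zero_pow] at h1
      linarith
    · rintro rfl
      rw [EdgeFun.norm_def, ← zero_smul ℂ (0 : E.EdgeFun), edgeInner_smul_right]
      simp

instance : NormedAddCommGroup E.EdgeFun := NormedAddCommGroup.ofCore EdgeFun.normedSpaceCore
instance : NormedSpace ℂ E.EdgeFun := NormedSpace.ofCore EdgeFun.normedSpaceCore

variable (E)

/-- Pointwise multiplication of `ξ ∈ C_c(W)` by `b ∈ C_b(W)`. -/
def edgeMulFun (b : W →ᵇ ℂ) (ξ : E.EdgeFun) : E.EdgeFun :=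
  (⟨⟨fun e => b e * ξ e, b.continuous.mul ξ.continuous⟩, ξ.hasCompactSupport.mul_left⟩ : C_c(W, ℂ))

@[simp] theorem edgeMulFun_apply (b : W →ᵇ ℂ) (ξ : E.EdgeFun) (e : W) :
    E.edgeMulFun b ξ e = b e * ξ e := rfl

theorem norm_edgeMulFun_le (b : W →ᵇ ℂ) (ξ : E.EdgeFun) : ‖E.edgeMulFun b ξ‖ ≤ ‖b‖ * ‖ξ‖ := by
  refine Real.sqrt_le_iff.2 ⟨mul_nonneg (norm_nonneg _) (norm_nonneg _), ?_⟩
  refine norm_le_of_apply (sq_nonneg _) fun v => ?_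
  rw [edgeInner_eq_sum (ζ := ξ) _ _ (fun e he => Or.inl (by simp [he]))]
  refine (norm_sum_le _ _).trans ?_
  rw [mul_pow]
  refine le_trans ?_ (mul_le_mul_of_nonneg_left (sum_le_norm_sq ξ v) (sq_nonneg _))
  rw [Finset.mul_sum]
  refine Finset.sum_le_sum fun e _ => ?_
  rw [norm_mul, norm_star, edgeMulFun_apply, norm_mul, ← sq, mul_pow]
  exact mul_le_mul_of_nonneg_right
    (pow_le_pow_left₀ (norm_nonneg _) (b.norm_coe_le_norm e) 2) (sq_nonneg _)

/-- Pointwise multiplication `C_b(W) × C_c(W) → C_c(W)` as a bounded bilinear map. -/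
def edgeMul : (W →ᵇ ℂ) →L[ℂ] E.EdgeFun →L[ℂ] E.EdgeFun :=
  LinearMap.mkContinuous₂
    (LinearMap.mk₂ ℂ E.edgeMulFun
      (fun b b' ξ => by ext e; simp [add_mul])
      (fun c b ξ => by ext e; simp [mul_assoc])
      (fun b ξ ξ' => by ext e; simp [mul_add])
      (fun c b ξ => by ext e; simp [mul_left_comm]))
    1 (fun b ξ => by simpa using E.norm_edgeMulFun_le b ξ)

/-- The inner product on `C_c(W)` as a bounded sesquilinear map. -/
def edgeInnerL : E.EdgeFun →L⋆[ℂ] E.EdgeFun →L[ℂ] C₀(V, ℂ) :=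
  LinearMap.mkContinuous₂
    (LinearMap.mk₂'ₛₗ (starRingEnd ℂ) (RingHom.id ℂ) E.edgeInner
      edgeInner_add_left edgeInner_smul_left edgeInner_add_right
      (fun c ξ η => edgeInner_smul_right c ξ η))
    1 (fun ξ η => by simpa using norm_edgeInner_le ξ η)

/-- The Hilbert `C₀(V)`-module `H(E)`: the completion of `C_c(W)`. -/
abbrev HilbertModule : Type v := UniformSpace.Completion E.EdgeFun

/-- The inclusion `C_c(W) → H(E)`. -/
def toHilbertModule : E.EdgeFun →L[ℂ] E.HilbertModule := UniformSpace.Completion.toComplL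

/-- The `C₀(V)`-valued inner product on `H(E)` (conjugate linear in the first variable), extending
the one on `C_c(W)` by continuity. -/
def innerL : E.HilbertModule →L⋆[ℂ] E.HilbertModule →L[ℂ] C₀(V, ℂ) :=
  ((E.edgeInnerL.extend E.toHilbertModule).flip.extend E.toHilbertModule).flip

/-- The action `λ : C_b(W) → B(H(E))` by pointwise multiplication, extended from `C_c(W)` by
continuity. -/
def multiplication : (W →ᵇ ℂ) →L[ℂ] E.HilbertModule →L[ℂ] E.HilbertModule :=
  (((ContinuousLinearMap.compL ℂ E.EdgeFun E.EdgeFun E.HilbertModule E.toHilbertModule).comp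
    E.edgeMul).flip.extend E.toHilbertModule).flip

theorem isUniformInducing_toHilbertModule : IsUniformInducing E.toHilbertModule :=
  UniformSpace.Completion.isUniformInducing_coe _

theorem denseRange_toHilbertModule : DenseRange E.toHilbertModule :=
  UniformSpace.Completion.denseRange_coe

@[simp] theorem innerL_toHilbertModule (ξ η : E.EdgeFun) :
    E.innerL (E.toHilbertModule ξ) (E.toHilbertModule η) = E.edgeInner ξ η := by
  rw [innerL, ContinuousLinearMap.flip_apply, ContinuousLinearMap.extend_eq _
    E.denseRange_toHilbertModule E.isUniformInducing_toHilbertModule,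
    ContinuousLinearMap.flip_apply, ContinuousLinearMap.extend_eq _
    E.denseRange_toHilbertModule E.isUniformInducing_toHilbertModule]
  rfl

@[simp] theorem multiplication_toHilbertModule (b : W →ᵇ ℂ) (ξ : E.EdgeFun) :
    E.multiplication b (E.toHilbertModule ξ) = E.toHilbertModule (E.edgeMulFun b ξ) := by
  rw [multiplication, ContinuousLinearMap.flip_apply, ContinuousLinearMap.extend_eq _
    E.denseRange_toHilbertModule E.isUniformInducing_toHilbertModule]
  rfl

end HilbertModule


section Representations

variable (E : TopologicalGraph V W)

/-- The pullback `a ↦ a ∘ p`, from `C₀(V)` to `C_b(W)`, along a continuous map `p : W → V`. -/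
def pullback (p : C(W, V)) : C₀(V, ℂ) →L[ℂ] (W →ᵇ ℂ) :=
  LinearMap.mkContinuous
    { toFun := fun a => a.toBCF.compContinuous p
      map_add' := fun _ _ => rfl
      map_smul' := fun _ _ => rfl }
    1 (fun a => by
      rw [one_mul]
      exact (BoundedContinuousFunction.norm_le (norm_nonneg _)).2
        fun e => norm_apply_le_norm a (p e))

@[simp] theorem pullback_apply (p : C(W, V)) (a : C₀(V, ℂ)) (e : W) :
    pullback p a e = a (p e) := rfl

/-- The left action `a · ξ = (a ∘ r) ξ` of `C₀(V)` on `H(E)`. -/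
def leftAction : C₀(V, ℂ) →L[ℂ] E.HilbertModule →L[ℂ] E.HilbertModule :=
  E.multiplication.comp (pullback ⟨E.r, E.continuous_r⟩)

/-- The right action `ξ · a = ξ (a ∘ s)` of `C₀(V)` on `H(E)`. -/
def rightAction : C₀(V, ℂ) →L[ℂ] E.HilbertModule →L[ℂ] E.HilbertModule :=
  E.multiplication.comp (pullback ⟨E.s, E.isLocalHomeomorph_s.continuous⟩)

/-- The rank one operator `ξ ⊗ η*`, `ζ ↦ ξ · ⟨η, ζ⟩`, on `H(E)`. -/
def rankOne (ξ η : E.HilbertModule) : E.HilbertModule →L[ℂ] E.HilbertModule :=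
  (E.rightAction.flip ξ).comp (E.innerL η)

theorem rankOne_apply (ξ η ζ : E.HilbertModule) :
    E.rankOne ξ η ζ = E.rightAction (E.innerL η ζ) ξ := rfl

/-- The compact operators `K(H(E))`: the closed linear span of the rank one operators. -/
def compacts : Submodule ℂ (E.HilbertModule →L[ℂ] E.HilbertModule) :=
  (Submodule.span ℂ (Set.range fun p : E.HilbertModule × E.HilbertModule =>
    E.rankOne p.1 p.2)).topologicalClosure

theorem rankOne_mem_compacts (ξ η : E.HilbertModule) : E.rankOne ξ η ∈ E.compacts :=
  Submodule.le_topologicalClosure _ (Submodule.subset_span ⟨(ξ, η), rfl⟩)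

/-- A Toeplitz representation `(π⁰, π¹)` of `E` on a C⋆-algebra `A`. -/
structure ToeplitzRep (A : Type*) [NonUnitalCStarAlgebra A] where
  π₀ : C₀(V, ℂ) →⋆ₙₐ[ℂ] A
  π₁ : E.HilbertModule →ₗ[ℂ] A
  star_π₁_mul_π₁ : ∀ ξ η, star (π₁ ξ) * π₁ η = π₀ (E.innerL ξ η)
  π₀_mul_π₁ : ∀ a ξ, π₀ a * π₁ ξ = π₁ (E.leftAction a ξ)

theorem multiplication_eq_rankOne {b : W →ᵇ ℂ} {ξ η : E.EdgeFun}
    (h : ∀ e, b e = ξ e * star (η e))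
    (hinj : ∀ e e', ξ e ≠ 0 → η e' ≠ 0 → E.s e = E.s e' → e = e') :
    E.multiplication b = E.rankOne (E.toHilbertModule ξ) (E.toHilbertModule η) := by
  refine ContinuousLinearMap.coeFn_injective
    (E.denseRange_toHilbertModule.equalizer (by fun_prop) (by fun_prop) (funext fun ζ => ?_))
  simp only [Function.comp_apply]
  rw [rankOne_apply, multiplication_toHilbertModule, innerL_toHilbertModule, rightAction,
    ContinuousLinearMap.comp_apply, multiplication_toHilbertModule]
  congr 1
  ext e
  rw [edgeMulFun_apply, edgeMulFun_apply, pullback_apply, h]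
  change _ = E.edgeInner η ζ (E.s e) * _
  by_cases he : ξ e = 0
  · simp [he]
  · rw [edgeInner_apply, E.fiberSum_eq_sum (t := {e}) (E.s e)]
    · rw [Finset.sum_singleton]; ring
    · intro e' h1 h2
      rw [Finset.mem_singleton]
      refine (hinj e e' he (fun h3 => h2 ?_) h1.symm).symm
      rw [h3]; simp
    · intro e' h1
      rw [Finset.mem_singleton.1 h1]

theorem multiplication_mem_compacts_of_hasCompactSupport (b : W →ᵇ ℂ) (hb : HasCompactSupport b) :
    E.multiplication b ∈ E.compacts := by
  choose g hg hgs using E.isLocalHomeomorph_s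
  obtain ⟨t, ht⟩ := IsCompact.elim_finite_subcover hb (fun x => (g x).source)
    (fun x => (g x).open_source) (fun x _ => Set.mem_iUnion.2 ⟨x, hg x⟩)
  let x : Fin t.card → W := fun i => (t.equivFin.symm i : W)
  obtain ⟨f, hf1, hf2, hf3, hf4⟩ := exists_continuous_sum_one_of_isOpen_isCompact
    (s := fun i => (g (x i)).source) (fun i => (g (x i)).open_source) hb (by
      refine ht.trans (Set.iUnion₂_subset fun y hy => ?_)
      refine Set.subset_iUnion_of_subset (t.equivFin ⟨y, hy⟩) ?_
      simp [x])
  let η : Fin t.card → E.EdgeFun := fun i =>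
    (⟨⟨fun e => (Real.sqrt (f i e) : ℂ), by fun_prop⟩,
      (hf4 i).comp_left (g := fun y : ℝ => (Real.sqrt y : ℂ)) (by simp)⟩ : C_c(W, ℂ))
  have hη : ∀ i e, η i e = (Real.sqrt (f i e) : ℂ) := fun _ _ => rfl
  have hηs : ∀ i e, η i e ≠ 0 → e ∈ (g (x i)).source := fun i e h =>
    hf1 i (subset_tsupport _ fun h0 => h (by rw [hη, h0]; simp))
  have hsum : b = ∑ i, BoundedContinuousFunction.ofNormedAddCommGroup
      (fun e => E.edgeMulFun b (η i) e * star (η i e))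
      ((E.edgeMulFun b (η i)).continuous.mul (η i).continuous.star) ‖b‖ (fun e => by
        have h1 := b.norm_coe_le_norm e
        have h2 := hf3 i e
        have h3 : ‖η i e‖ ≤ 1 := by
          rw [hη, Complex.norm_real, Real.norm_eq_abs, abs_of_nonneg (Real.sqrt_nonneg _)]
          exact Real.sqrt_le_one.2 h2.2
        rw [norm_mul, norm_star, edgeMulFun_apply, norm_mul]
        have h4 : ‖b e‖ * ‖η i e‖ ≤ ‖b e‖ * 1 := by gcongr
        calc ‖b e‖ * ‖η i e‖ * ‖η i e‖ ≤ (‖b e‖ * 1) * 1 := by gcongr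
          _ ≤ ‖b‖ := by simpa using h1) := by
    ext e
    rw [BoundedContinuousFunction.coe_sum, Finset.sum_apply]
    have h1 : ∀ i, E.edgeMulFun b (η i) e * star (η i e) = b e * (f i e : ℂ) := by
      intro i
      rw [edgeMulFun_apply, hη, mul_assoc]
      congr 1
      rw [Complex.star_def, Complex.conj_ofReal, ← Complex.ofReal_mul,
        Real.mul_self_sqrt (hf3 i e).1]
    refine Eq.trans ?_ (Finset.sum_congr rfl fun i _ => (h1 i).symm)
    rw [← Finset.mul_sum]
    by_cases he : b e = 0
    · simp [he]
    · have h2 := hf2 (subset_tsupport b he)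
      simp only [Finset.sum_apply, Pi.one_apply] at h2
      rw [← Complex.ofReal_sum, h2]; simp
  rw [hsum, map_sum]
  refine Submodule.sum_mem _ fun i _ => ?_
  rw [E.multiplication_eq_rankOne (ξ := E.edgeMulFun b (η i)) (η := η i) (fun e => rfl)]
  · exact E.rankOne_mem_compacts _ _
  · intro e e' h1 h2 h3
    have he : e ∈ (g (x i)).source := hηs i e fun h => h1 (by rw [edgeMulFun_apply, h, mul_zero])
    rw [hgs (x i)] at h3
    exact (g (x i)).injOn he (hηs i e' h2) h3

/-- Multiplication by a function vanishing at infinity is a compact operator on `H(E)`. -/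
theorem multiplication_mem_compacts (b : W →ᵇ ℂ) (hb : ∀ ε > 0, IsCompact {e | ε ≤ ‖b e‖}) :
    E.multiplication b ∈ E.compacts := by
  have hcl : IsClosed (E.multiplication ⁻¹' (E.compacts : Set _)) :=
    (Submodule.isClosed_topologicalClosure _).preimage E.multiplication.continuous
  change b ∈ E.multiplication ⁻¹' (E.compacts : Set _)
  rw [← hcl.closure_eq, Metric.mem_closure_iff]
  intro ε hε
  obtain ⟨χ, h1, -, h3, h4⟩ := exists_continuous_one_zero_of_isCompact (hb (ε / 2) (by positivity))
    isClosed_empty (Set.disjoint_empty _)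
  have hχ : ∀ e, ‖(χ e : ℂ)‖ ≤ 1 := fun e => by
    rw [Complex.norm_real, Real.norm_eq_abs, abs_of_nonneg (h4 e).1]; exact (h4 e).2
  let c : W →ᵇ ℂ := BoundedContinuousFunction.ofNormedAddCommGroup (fun e => (χ e : ℂ) * b e)
    (by fun_prop) ‖b‖ (fun e => by
      rw [norm_mul]
      exact (mul_le_of_le_one_left (norm_nonneg _) (hχ e)).trans (b.norm_coe_le_norm e))
  refine ⟨c, E.multiplication_mem_compacts_of_hasCompactSupport c ?_, ?_⟩
  · exact HasCompactSupport.mul_right (h3.comp_left (g := fun y : ℝ => (y : ℂ)) (by simp))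
  · refine lt_of_le_of_lt ((BoundedContinuousFunction.dist_le (by positivity)).2 fun e => ?_)
      (half_lt_self hε)
    rw [dist_eq_norm]
    change ‖b e - (χ e : ℂ) * b e‖ ≤ _
    by_cases he : ε / 2 ≤ ‖b e‖
    · rw [h1 he]; simp; positivity
    · have : b e - (χ e : ℂ) * b e = ((1 - χ e : ℝ) : ℂ) * b e := by push_cast; ring
      rw [this, norm_mul, Complex.norm_real, Real.norm_eq_abs,
        abs_of_nonneg (by linarith [(h4 e).2])]
      exact (mul_le_of_le_one_left (norm_nonneg _) (by linarith [(h4 e).1])).trans (not_le.1 he).le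

theorem isCompact_preimage_of_subset_regular {C : Set V} (hC : IsCompact C)
    (h : C ⊆ E.regularVertices) : IsCompact (E.r ⁻¹' C) := by
  have hloc : ∀ v ∈ C, ∃ N ∈ 𝓝[C] v, IsCompact (E.r ⁻¹' N) := by
    intro v hv
    obtain ⟨U, ⟨hUo, hUp, -⟩, hvU⟩ := h hv
    obtain ⟨N, hN, hNU, hNc⟩ := local_compact_nhds (hUo.mem_nhds hvU)
    refine ⟨N, mem_nhdsWithin_of_mem_nhds hN, ?_⟩
    have h1 : IsCompact ((↑) ⁻¹' N : Set U) :=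
      (Topology.IsInducing.subtypeVal.isCompact_preimage_iff (by simpa using hNU)).2 hNc
    have h2 := (hUp.isCompact_preimage h1).image continuous_subtype_val
    convert h2 using 1
    ext e
    simp only [Set.mem_preimage, Set.mem_image, Subtype.exists, Set.restrictPreimage_mk,
      exists_and_right, exists_eq_right]
    exact ⟨fun he => ⟨hNU he, he⟩, fun ⟨_, he⟩ => he⟩
  refine hC.induction_on (p := fun S => ∃ S', S ⊆ S' ∧ IsCompact (E.r ⁻¹' S')) ?_ ?_ ?_ ?_
    |>.elim fun S hS => hS.2.of_isClosed_subset (hC.isClosed.preimage E.continuous_r)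
      (Set.preimage_mono hS.1)
  · exact ⟨∅, subset_rfl, by simp⟩
  · exact fun S S' h1 ⟨S'', h2, h3⟩ => ⟨S'', h1.trans h2, h3⟩
  · exact fun S S' ⟨T, h1, h2⟩ ⟨T', h3, h4⟩ =>
      ⟨T ∪ T', Set.union_subset_union h1 h3, by rw [Set.preimage_union]; exact h2.union h4⟩
  · exact fun v hv => let ⟨N, h1, h2⟩ := hloc v hv; ⟨N, h1, N, subset_rfl, h2⟩

/-- `λ(a ∘ r)` is compact for `a ∈ C₀(E⁰_reg)`. -/
theorem leftAction_mem_compacts {a : C₀(V, ℂ)} (ha : ∀ v ∉ E.regularVertices, a v = 0) :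
    E.leftAction a ∈ E.compacts := by
  refine E.multiplication_mem_compacts _ fun ε hε => ?_
  have hC : IsCompact {v | ε ≤ ‖a v‖} := by
    have h1 := a.zero_at_infty'.norm.eventually_lt_const (u := ε) (by simpa using hε)
    obtain ⟨K, hK, hK'⟩ := Filter.mem_cocompact.1 h1
    refine hK.of_isClosed_subset (isClosed_le continuous_const a.continuous.norm) fun v hv => ?_
    by_contra hvK
    have h2 : ‖a v‖ < ε := hK' hvK
    exact absurd h2 (not_lt.2 hv)
  refine E.isCompact_preimage_of_subset_regular hC fun v hv => ?_
  by_contra hne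
  have : ε ≤ ‖a v‖ := hv
  rw [ha v hne, norm_zero] at this
  exact absurd hε (not_lt.2 this)

variable {E}

theorem norm_innerL_self_le (ξ : E.HilbertModule) : ‖E.innerL ξ ξ‖ ≤ ‖ξ‖ ^ 2 := by
  induction ξ using UniformSpace.Completion.induction_on with
  | hp =>
    refine isClosed_le (Continuous.norm ?_) (by fun_prop)
    exact E.innerL.continuous.clm_apply continuous_id
  | ih ξ =>
    rw [show (ξ : E.HilbertModule) = E.toHilbertModule ξ from rfl, innerL_toHilbertModule,
      ← EdgeFun.norm_sq]
    exact le_of_eq (congrArg (· ^ 2) (UniformSpace.Completion.norm_coe ξ).symm)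

theorem ToeplitzRep.norm_π₁_le {A : Type*} [NonUnitalCStarAlgebra A] (π : E.ToeplitzRep A)
    (ξ : E.HilbertModule) : ‖π.π₁ ξ‖ ≤ ‖ξ‖ := by
  refine (abs_le_of_sq_le_sq' ?_ (norm_nonneg _)).2
  rw [sq, ← CStarRing.norm_star_mul_self, π.star_π₁_mul_π₁]
  exact (NonUnitalStarAlgHom.norm_apply_le π.π₀ _).trans (norm_innerL_self_le ξ)

/-- A Toeplitz representation is covariant if `φ(λ(a ∘ r)) = π⁰(a)` for all
`a ∈ C₀(E⁰_reg)` (the functions in `C₀(V)` which vanish at all singular vertices), where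
`φ : K(H(E)) → A` is the map with `φ(ξ ⊗ η*) = π¹(ξ) π¹(η)*`. These values and
continuity determine `φ`; being a `⋆`-homomorphism, it is contractive. -/
def ToeplitzRep.IsCovariant {A : Type*} [NonUnitalCStarAlgebra A] (π : E.ToeplitzRep A) : Prop :=
  ∃ φ : E.compacts →ₗ[ℂ] A, (∀ T, ‖φ T‖ ≤ ‖T‖) ∧
    (∀ ξ η, φ ⟨E.rankOne ξ η, E.rankOne_mem_compacts ξ η⟩ = π.π₁ ξ * star (π.π₁ η)) ∧
    ∀ (a : C₀(V, ℂ)) (ha : ∀ v ∉ E.regularVertices, a v = 0),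
      φ ⟨E.leftAction a, E.leftAction_mem_compacts ha⟩ = π.π₀ a

variable (E)

/-- A covariant representation of `E` on some C⋆-algebra in the universe of `E`. -/
structure CovariantRep : Type (max u v + 1) where
  carrier : Type (max u v)
  [cstar : NonUnitalCStarAlgebra carrier]
  rep : E.ToeplitzRep carrier
  covariant : rep.IsCovariant

attribute [instance] CovariantRep.cstar

/-- The `ℓ^∞`-product of the target C⋆-algebras of all covariant representations of `E`. -/
abbrev RepProduct : Type (max u v + 1) := lp (fun ρ : E.CovariantRep => ρ.carrier) ∞

/-- The direct sum of the maps `π⁰` of all covariant representations. -/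
def sumπ₀ : C₀(V, ℂ) →⋆ₙₐ[ℂ] E.RepProduct where
  toFun a := ⟨fun ρ => ρ.rep.π₀ a, memℓp_infty ⟨‖a‖, by
    rintro _ ⟨ρ, rfl⟩; exact NonUnitalStarAlgHom.norm_apply_le ρ.rep.π₀ a⟩⟩
  map_smul' c a := by ext ρ; exact map_smul ρ.rep.π₀ c a
  map_zero' := by ext ρ; exact map_zero ρ.rep.π₀
  map_add' a b := by ext ρ; exact map_add ρ.rep.π₀ a b
  map_mul' a b := by ext ρ; exact map_mul ρ.rep.π₀ a b
  map_star' a := by ext ρ; exact map_star ρ.rep.π₀ a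

/-- The direct sum of the maps `π¹` of all covariant representations. -/
def sumπ₁ : E.HilbertModule →ₗ[ℂ] E.RepProduct where
  toFun ξ := ⟨fun ρ => ρ.rep.π₁ ξ, memℓp_infty ⟨‖ξ‖, by
    rintro _ ⟨ρ, rfl⟩; exact ρ.rep.norm_π₁_le ξ⟩⟩
  map_add' ξ η := by ext ρ; exact map_add ρ.rep.π₁ ξ η
  map_smul' c ξ := by ext ρ; exact map_smul ρ.rep.π₁ c ξ

/-- The C⋆-subalgebra of the product generated by the direct sum of all covariant
representations. -/
def cstarSubalgebra : NonUnitalStarSubalgebra ℂ E.RepProduct :=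
  (NonUnitalStarAlgebra.adjoin ℂ
    (Set.range E.sumπ₀ ∪ Set.range E.sumπ₁)).topologicalClosure

instance isClosed_cstarSubalgebra : IsClosed (E.cstarSubalgebra : Set E.RepProduct) :=
  NonUnitalStarSubalgebra.isClosed_topologicalClosure _

/-- The topological graph algebra `C⋆(E)`: the universal C⋆-algebra generated by a covariant
representation of `E`, realized as the C⋆-algebra generated by the direct sum of all of them. -/
abbrev GraphAlgebra : Type (max u v + 1) := E.cstarSubalgebra

theorem sumπ₀_mem (a : C₀(V, ℂ)) : E.sumπ₀ a ∈ E.cstarSubalgebra :=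
  NonUnitalStarSubalgebra.le_topologicalClosure _
    (NonUnitalStarAlgebra.subset_adjoin ℂ _ (Or.inl ⟨a, rfl⟩))

theorem sumπ₁_mem (ξ : E.HilbertModule) : E.sumπ₁ ξ ∈ E.cstarSubalgebra :=
  NonUnitalStarSubalgebra.le_topologicalClosure _
    (NonUnitalStarAlgebra.subset_adjoin ℂ _ (Or.inr ⟨ξ, rfl⟩))

/-- The canonical representation of `E` on `C⋆(E)`. -/
def universalRep : E.ToeplitzRep E.GraphAlgebra where
  π₀ := NonUnitalStarAlgHom.codRestrict E.sumπ₀ E.cstarSubalgebra E.sumπ₀_mem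
  π₁ := E.sumπ₁.codRestrict E.cstarSubalgebra.toSubmodule E.sumπ₁_mem
  star_π₁_mul_π₁ ξ η := by
    ext ρ
    exact ρ.rep.star_π₁_mul_π₁ ξ η
  π₀_mul_π₁ a ξ := by
    ext ρ
    exact ρ.rep.π₀_mul_π₁ a ξ

theorem universalRep_isCovariant : E.universalRep.IsCovariant := by
  choose φ h1 h2 h3 using fun ρ : E.CovariantRep => ρ.covariant
  let Φ : E.compacts →ₗ[ℂ] E.RepProduct :=
    { toFun := fun T => ⟨fun ρ => φ ρ T, memℓp_infty ⟨‖T‖, by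
        rintro _ ⟨ρ, rfl⟩; exact h1 ρ T⟩⟩
      map_add' := fun S T => by ext ρ; exact map_add (φ ρ) S T
      map_smul' := fun c T => by ext ρ; exact map_smul (φ ρ) c T }
  have hΦ : ∀ T, ‖Φ T‖ ≤ ‖T‖ := fun T =>
    lp.norm_le_of_forall_le (norm_nonneg _) fun ρ => h1 ρ T
  have hrank : ∀ ξ η, Φ ⟨E.rankOne ξ η, E.rankOne_mem_compacts ξ η⟩
      = E.sumπ₁ ξ * star (E.sumπ₁ η) := fun ξ η => by
    ext ρ; exact h2 ρ ξ η
  have hmem : ∀ T, Φ T ∈ E.cstarSubalgebra.toSubmodule := by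
    have hΦc : Continuous Φ := AddMonoidHomClass.continuous_of_bound Φ 1 (by simpa using hΦ)
    let P : Submodule ℂ E.compacts := E.cstarSubalgebra.toSubmodule.comap Φ
    have hP : IsClosed (P : Set E.compacts) :=
      E.isClosed_cstarSubalgebra.preimage hΦc
    have hle : E.compacts ≤ P.map E.compacts.subtype := by
      refine Submodule.topologicalClosure_minimal _ (Submodule.span_le.2 ?_) ?_
      · rintro _ ⟨p, rfl⟩
        refine ⟨⟨E.rankOne p.1 p.2, E.rankOne_mem_compacts _ _⟩, ?_, rfl⟩
        change Φ _ ∈ E.cstarSubalgebra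
        rw [hrank]
        exact mul_mem (E.sumπ₁_mem _) (star_mem (E.sumπ₁_mem _))
      · exact (Submodule.isClosed_topologicalClosure _).isClosedEmbedding_subtypeVal.isClosedMap
          _ hP
    intro T
    obtain ⟨S, hS, hST⟩ := hle T.2
    rwa [← Subtype.ext hST]
  refine ⟨Φ.codRestrict _ hmem, hΦ, fun ξ η => Subtype.ext (hrank ξ η), fun a ha => ?_⟩
  ext ρ
  exact h3 ρ a ha

/-- The universal property of `C⋆(E)`. The restriction on the universe of `ρ.carrier` is harmless:
the image of a covariant representation generates a C⋆-algebra which has a copy in that universe. -/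
theorem existsUnique_lift (ρ : E.CovariantRep) :
    ∃! ψ : E.GraphAlgebra →⋆ₙₐ[ℂ] ρ.carrier,
      (∀ a, ψ (E.universalRep.π₀ a) = ρ.rep.π₀ a) ∧ ∀ ξ, ψ (E.universalRep.π₁ ξ) = ρ.rep.π₁ ξ := by
  let ev : E.GraphAlgebra →⋆ₙₐ[ℂ] ρ.carrier :=
    { toFun := fun x => x.1 ρ
      map_smul' := fun _ _ => rfl
      map_zero' := rfl
      map_add' := fun _ _ => rfl
      map_mul' := fun _ _ => rfl
      map_star' := fun _ => rfl }
  refine ⟨ev, ⟨fun a => rfl, fun ξ => rfl⟩, fun ψ hψ => ?_⟩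
  have hc : ∀ χ : E.GraphAlgebra →⋆ₙₐ[ℂ] ρ.carrier, Continuous χ := fun χ =>
    AddMonoidHomClass.continuous_of_bound χ 1
      (fun x => by simpa using NonUnitalStarAlgHom.norm_apply_le χ x)
  let Q : NonUnitalStarSubalgebra ℂ E.GraphAlgebra := NonUnitalStarAlgHom.equalizer ψ ev
  have hQ : IsClosed (Q : Set E.GraphAlgebra) := isClosed_eq (hc ψ) (hc ev)
  have hle : E.cstarSubalgebra ≤
      Q.map (NonUnitalStarSubalgebraClass.subtype E.cstarSubalgebra) := by
    refine NonUnitalStarSubalgebra.topologicalClosure_minimal _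
      (NonUnitalStarAlgebra.adjoin_le ?_) ?_
    · rintro _ (⟨a, rfl⟩ | ⟨ξ, rfl⟩)
      · exact ⟨E.universalRep.π₀ a, hψ.1 a, rfl⟩
      · exact ⟨E.universalRep.π₁ ξ, hψ.2 ξ, rfl⟩
    · exact E.isClosed_cstarSubalgebra.isClosedEmbedding_subtypeVal.isClosedMap _ hQ
  ext x
  obtain ⟨y, hy, hyx⟩ := hle x.2
  have hyx' : y = x := Subtype.ext hyx
  rw [← hyx']
  exact hy

/-- A Toeplitz representation with `π¹` multiplied by a scalar `z` of modulus one. -/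
@[simps] def ToeplitzRep.twist {E : TopologicalGraph V W} {A : Type*} [NonUnitalCStarAlgebra A]
    (π : E.ToeplitzRep A) (z : Circle) : E.ToeplitzRep A where
  π₀ := π.π₀
  π₁ := (z : ℂ) • π.π₁
  star_π₁_mul_π₁ ξ η := by
    rw [← π.star_π₁_mul_π₁, LinearMap.smul_apply, LinearMap.smul_apply, star_smul,
      smul_mul_smul_comm]
    simp [← Circle.coe_inv_eq_conj]
  π₀_mul_π₁ a ξ := by
    rw [LinearMap.smul_apply, LinearMap.smul_apply, mul_smul_comm, π.π₀_mul_π₁]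

theorem ToeplitzRep.IsCovariant.twist {E : TopologicalGraph V W} {A : Type*}
    [NonUnitalCStarAlgebra A] {π : E.ToeplitzRep A} (h : π.IsCovariant) (z : Circle) :
    (π.twist z).IsCovariant := by
  obtain ⟨φ, h1, h2, h3⟩ := h
  refine ⟨φ, h1, fun ξ η => ?_, h3⟩
  rw [h2, twist_π₁, LinearMap.smul_apply, LinearMap.smul_apply, star_smul, smul_mul_smul_comm]
  simp [← Circle.coe_inv_eq_conj]

/-- The covariant representation `(π⁰, z π¹)`. -/
def CovariantRep.twist {E : TopologicalGraph V W} (ρ : E.CovariantRep) (z : Circle) :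
    E.CovariantRep :=
  ⟨ρ.carrier, ρ.rep.twist z, ρ.covariant.twist z⟩

/-- The endomorphism of the product which replaces the coordinate at `(π⁰, π¹)` by the one at
`(π⁰, z π¹)`. -/
def gaugeProduct (z : Circle) : E.RepProduct →⋆ₙₐ[ℂ] E.RepProduct where
  toFun x := ⟨fun ρ => x.1 (ρ.twist z), memℓp_infty ⟨‖x‖, by
    rintro _ ⟨ρ, rfl⟩; exact lp.norm_apply_le_norm ENNReal.top_ne_zero x (ρ.twist z)⟩⟩
  map_smul' _ _ := rfl
  map_zero' := rfl
  map_add' _ _ := rfl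
  map_mul' _ _ := rfl
  map_star' _ := rfl

theorem gaugeProduct_sumπ₀ (z : Circle) (a : C₀(V, ℂ)) :
    E.gaugeProduct z (E.sumπ₀ a) = E.sumπ₀ a := rfl

theorem gaugeProduct_sumπ₁ (z : Circle) (ξ : E.HilbertModule) :
    E.gaugeProduct z (E.sumπ₁ ξ) = (z : ℂ) • E.sumπ₁ ξ := rfl

theorem gaugeProduct_mem (z : Circle) {x : E.RepProduct} (hx : x ∈ E.cstarSubalgebra) :
    E.gaugeProduct z x ∈ E.cstarSubalgebra := by
  have hle : E.cstarSubalgebra ≤ E.cstarSubalgebra.comap (E.gaugeProduct z) := by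
    refine NonUnitalStarSubalgebra.topologicalClosure_minimal _
      (NonUnitalStarAlgebra.adjoin_le ?_) ?_
    · rintro _ (⟨a, rfl⟩ | ⟨ξ, rfl⟩)
      · exact E.sumπ₀_mem a
      · exact SMulMemClass.smul_mem (z : ℂ) (E.sumπ₁_mem ξ)
    · exact E.isClosed_cstarSubalgebra.preimage
        (AddMonoidHomClass.continuous_of_bound (E.gaugeProduct z) 1
          (fun x => by simpa using NonUnitalStarAlgHom.norm_apply_le (E.gaugeProduct z) x))
  exact hle hx

/-- The gauge action `γ` of the circle on `C⋆(E)`: the endomorphism `γ_z` fixes `π⁰(a)` and sends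
`π¹(ξ)` to `z π¹(ξ)`. -/
def gauge (z : Circle) : E.GraphAlgebra →⋆ₙₐ[ℂ] E.GraphAlgebra :=
  NonUnitalStarAlgHom.codRestrict
    ((E.gaugeProduct z).comp (NonUnitalStarSubalgebraClass.subtype E.cstarSubalgebra))
    E.cstarSubalgebra (fun x => E.gaugeProduct_mem z x.2)

@[simp] theorem gauge_π₀ (z : Circle) (a : C₀(V, ℂ)) :
    E.gauge z (E.universalRep.π₀ a) = E.universalRep.π₀ a := rfl

@[simp] theorem gauge_π₁ (z : Circle) (ξ : E.HilbertModule) :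
    E.gauge z (E.universalRep.π₁ ξ) = (z : ℂ) • E.universalRep.π₁ ξ := rfl

end Representations

end TopologicalGraph

/-- A tracial state on a C⋆-algebra: a positive linear functional of norm one with
`τ(xy) = τ(yx)`. -/
structure IsTracialState {A : Type*} [NonUnitalCStarAlgebra A] (τ : A →L[ℂ] ℂ) : Prop where
  nonneg : ∀ x, 0 ≤ τ (star x * x)
  norm_eq_one : ‖τ‖ = 1
  trace : ∀ x y, τ (x * y) = τ (y * x)

end

/-!
For each `k ≥ 1` a product `π¹(ξ₁) ⋯ π¹(ξₖ)` with `ξᵢ ∈ C_c(W)` has trace zero. Indeed, without cycles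
every sequence of edges `e₁, …, eₖ`, read cyclically, has a place with `s(eᵢ) ≠ r(eᵢ₊₁)`. By
compactness and a partition of unity (`exists_finite_cover_of_forall_exists_ne`,
`EdgeFun.exists_eq_sum`) one may assume that for some `i` the sets `s(supp ξᵢ)` and
`r(supp ξᵢ₊₁)` are disjoint. Then there is an `a ∈ C₀(V)` with `π¹(ξᵢ) π⁰(a) = π¹(ξᵢ)` and
`π⁰(a) π¹(ξᵢ₊₁) = 0` (`ToeplitzRep.exists_separating`), and since the trace only sees the cyclic order
of the factors, it vanishes (`trace_prod_eq_zero`). By continuity this holds for `ξᵢ ∈ H(E)`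
(`trace_prod_π₁_eq_zero`).

A word in the elements `π⁰(a)`, `π¹(ξ)`, `π¹(ξ)⋆` is an eigenvector of the gauge action `γ_z` with
eigenvalue `z ^ d`, where the degree `d` is the number of factors `π¹(ξ)` minus the number of factors
`π¹(ξ)⋆`. If `d > 0`, then the relations `π⁰(a) π¹(ξ) = π¹(a · ξ)` and `π¹(η)⋆ π¹(ξ) = π⁰(⟨η, ξ⟩)`,
applied after cyclic rotations, reduce the word to a product as above, so that its trace is zero
(`trace_evalWord_eq_zero_of_pos`); the case `d < 0` follows by taking adjoints. Hence `τ ∘ γ_z` and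
`τ` agree on all words, and these span a dense subspace (`eq_top_of_forall_evalWord_mem`).

Products are formed in the unitization, where empty products make sense; the trace extends to it.
-/

noncomputable section

open scoped ZeroAtInfty CompactlySupported BoundedContinuousFunction ENNReal ComplexOrder Topology

/-! ### Finite covers adapted to an acyclic relation -/

open Filter Uniformity in
/-- If every cyclic sequence of `n + 1` points has a place where the maps `s` and `r` disagree, then
a compact set has a finite open cover such that for every sequence of `n + 1` members of the cover
the images under `s` and `r` are disjoint in one and the same place. The cover comes from a Lebesgue
number in the compact space `K ^ (n + 1)`. -/
theorem exists_finite_cover_of_forall_exists_ne {V W : Type*} [TopologicalSpace V] [T2Space V]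
    [TopologicalSpace W] [T2Space W] {s r : W → V} (hs : Continuous s) (hr : Continuous r) {n : ℕ}
    (h : ∀ x : Fin (n + 1) → W, ∃ i, s (x i) ≠ r (x (i + 1))) {K : Set W} (hK : IsCompact K) :
    ∃ (m : ℕ) (U : Fin m → Set W), (∀ j, IsOpen (U j)) ∧ K ⊆ ⋃ j, U j ∧
      ∀ c : Fin (n + 1) → Fin m, ∃ i, ∀ e ∈ K ∩ U (c i), ∀ f ∈ K ∩ U (c (i + 1)), s e ≠ r f := by
  have : CompactSpace K := isCompact_iff_compactSpace.1 hK
  let _ : UniformSpace K := uniformSpaceOfCompactR1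
  -- Indexing by pairs of disjoint open sets, rather than by points where `s (x i) ≠ r (x (i + 1))`,
  -- makes the two conditions independent of each other, also when `i = i + 1`.
  let ι := {p : Fin (n + 1) × Set V × Set V // IsOpen p.2.1 ∧ IsOpen p.2.2 ∧ Disjoint p.2.1 p.2.2}
  let G : ι → Set (Fin (n + 1) → K) := fun p =>
    {x | s (x p.1.1) ∈ p.1.2.1 ∧ r (x (p.1.1 + 1)) ∈ p.1.2.2}
  obtain ⟨N, hN, hNG⟩ := lebesgue_number_lemma (U := G) isCompact_univ
    (fun p => (p.2.1.preimage (by fun_prop)).inter (p.2.2.1.preimage (by fun_prop)))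
    (fun x _ => by
      obtain ⟨i, hi⟩ := h fun j => x j
      obtain ⟨A, B, hA, hB, hxA, hxB, hAB⟩ := t2_separation hi
      exact Set.mem_iUnion.2 ⟨⟨(i, A, B), hA, hB, hAB⟩, hxA, hxB⟩)
  rw [Pi.uniformity, mem_iInf_of_finite] at hN
  obtain ⟨S, hS, rfl⟩ := hN
  choose T hT hTS using fun i => mem_comap.1 (hS i)
  have hT' : ⋂ i, T i ∈ 𝓤 K := iInter_mem.2 hT
  choose O hO hOT using fun x : K =>
    mem_nhds_subtype K x _ |>.1 (UniformSpace.ball_mem_nhds x hT')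
  obtain ⟨t, ht⟩ := hK.elim_finite_subcover (fun x : K => interior (O x))
    (fun x => isOpen_interior)
    (fun x hx => Set.mem_iUnion.2 ⟨⟨x, hx⟩, mem_interior_iff_mem_nhds.2 (hO ⟨x, hx⟩)⟩)
  refine ⟨t.card, fun j => interior (O (t.equivFin.symm j)), fun j => isOpen_interior,
    ht.trans (Set.iUnion₂_subset fun y hy => ?_), fun c => ?_⟩
  · exact Set.subset_iUnion_of_subset (t.equivFin ⟨y, hy⟩) (by simp)
  · let y : Fin (n + 1) → K := fun i => (t.equivFin.symm (c i) : K)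
    have hy : ∀ i (e : K), (e : W) ∈ interior (O (y i)) → e ∈ UniformSpace.ball (y i) (⋂ i, T i) :=
      fun i e he => hOT (y i) (interior_subset (s := O (y i)) he)
    have hball : ∀ x : Fin (n + 1) → K, (∀ i, x i ∈ UniformSpace.ball (y i) (⋂ i, T i)) →
        x ∈ UniformSpace.ball y (⋂ i, S i) := fun x hx =>
      Set.mem_iInter.2 fun i => hTS i (Set.mem_iInter.1 (hx i) i)
    obtain ⟨⟨⟨i, A, B⟩, hA, hB, hAB⟩, hG⟩ := hNG y (Set.mem_univ y)
    have hself : ∀ i, y i ∈ UniformSpace.ball (y i) (⋂ i, T i) := fun i =>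
      UniformSpace.mem_ball_self _ hT'
    refine ⟨i, fun e he f hf => ?_⟩
    have h1 := (hG (hball (Function.update y i ⟨e, he.1⟩) fun j => by
      rcases eq_or_ne j i with rfl | hj
      · simpa using hy j ⟨e, he.1⟩ he.2
      · simpa [hj] using hself j)).1
    have h2 := (hG (hball (Function.update y (i + 1) ⟨f, hf.1⟩) fun j => by
      rcases eq_or_ne j (i + 1) with rfl | hj
      · simpa using hy _ ⟨f, hf.1⟩ hf.2
      · simpa [hj] using hself j)).2
    simp only [Function.update_self] at h1 h2
    exact fun heq => Set.disjoint_left.1 hAB h1 (heq ▸ h2)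

/-! ### Traces of products -/

section Trace

variable {B : Type*} [Ring B] [Algebra ℂ B] {φ : B →ₗ[ℂ] ℂ}

theorem trace_prod_rotate (hφ : ∀ x y, φ (x * y) = φ (y * x)) {n : ℕ} (q : Fin (n + 1) → B)
    (m : Fin (n + 1)) :
    φ (List.ofFn fun j => q (j + m)).prod = φ (List.ofFn q).prod := by
  induction m using Fin.induction with
  | zero => simp
  | succ m ih =>
    have h1 : Fin.last n + m.succ = 0 + m.castSucc := by
      rw [← Fin.coeSucc_eq_succ, add_left_comm, Fin.last_add_one, add_zero, zero_add]
    have h2 : ∀ j : Fin n, j.castSucc + m.succ = j.succ + m.castSucc := fun j => by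
      rw [← Fin.coeSucc_eq_succ, ← Fin.coeSucc_eq_succ, add_assoc, add_comm 1]
    rw [← ih, List.ofFn_succ' (f := fun j => q (j + m.succ)),
      List.ofFn_succ (f := fun j => q (j + m.castSucc)), List.concat_eq_append, List.prod_append,
      List.prod_singleton, List.prod_cons, hφ]
    simp only [h1, h2]

/-- A trace vanishes on a product if some element `c` is a right unit for one factor and annihilates
the cyclically next one. This includes the case of a single factor, which is its own successor. -/
theorem trace_prod_eq_zero (hφ : ∀ x y, φ (x * y) = φ (y * x)) {n : ℕ} (q : Fin (n + 1) → B)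
    {c : B} {i : Fin (n + 1)} (h : q i * c = q i) (h' : c * q (i + 1) = 0) :
    φ (List.ofFn q).prod = 0 := by
  rw [← trace_prod_rotate hφ q (i + 1)]
  set p : Fin (n + 1) → B := fun j => q (j + (i + 1)) with hp
  have h1 : (List.ofFn p).prod * c = (List.ofFn p).prod := by
    rw [List.ofFn_succ', List.concat_eq_append, List.prod_append, List.prod_singleton, mul_assoc,
      hp]
    dsimp only
    rw [add_left_comm, Fin.last_add_one, add_zero, h]
  have h2 : c * (List.ofFn p).prod = 0 := by
    rw [List.ofFn_succ, List.prod_cons, ← mul_assoc, hp]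
    dsimp only
    rw [zero_add, h', zero_mul]
  rw [← h1, hφ, h2, map_zero]

end Trace

namespace TopologicalGraph

variable {V : Type u} {W : Type v}
  [TopologicalSpace V] [LocallyCompactSpace V] [T2Space V]
  [TopologicalSpace W] [LocallyCompactSpace W] [T2Space W] {E : TopologicalGraph V W}

theorem exists_source_ne_range (hE : ¬ ∃ α : List W, E.IsCycle α) {n : ℕ} (x : Fin (n + 1) → W) :
    ∃ i, E.s (x i) ≠ E.r (x (i + 1)) := by
  by_contra! h
  refine hE ⟨List.ofFn x, List.isChain_ofFn.2 fun i hi => ?_, by simp, ?_⟩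
  · rw [h]
    congr 2
    rw [Fin.ext_iff, Fin.val_add_one_of_lt' hi]
  · rw [List.getLast_ofFn, List.head_ofFn]
    have := h (Fin.last n)
    rw [Fin.last_add_one] at this
    exact this

/-! ### Toeplitz representations and traces of products of creation operators -/

variable {A : Type*} [NonUnitalCStarAlgebra A] (π : E.ToeplitzRep A)

namespace ToeplitzRep

theorem π₁_mul_π₀_eq_self {ξ : E.EdgeFun} {a : C₀(V, ℂ)} (h : ∀ e ∈ tsupport ξ, a (E.s e) = 1) :
    π.π₁ (E.toHilbertModule ξ) * π.π₀ a = π.π₁ (E.toHilbertModule ξ) := by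
  have h1 : E.edgeInner ξ ξ * a = E.edgeInner ξ ξ := by
    ext v
    rw [ZeroAtInftyContinuousMap.mul_apply, edgeInner_apply]
    by_cases hv : ∃ e ∈ tsupport ξ, E.s e = v
    · obtain ⟨e, he, rfl⟩ := hv
      rw [h e he, mul_one]
    · rw [fiberSum, finsum_mem_eq_zero_of_forall_eq_zero fun e he => ?_, zero_mul]
      rw [image_eq_zero_of_notMem_tsupport fun he' => hv ⟨e, he', he⟩, mul_zero]
  have h2 : star (π.π₁ (E.toHilbertModule ξ)) * π.π₁ (E.toHilbertModule ξ)
      = π.π₀ (E.edgeInner ξ ξ) := by rw [π.star_π₁_mul_π₁, innerL_toHilbertModule]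
  have h3 : star (π.π₁ (E.toHilbertModule ξ)) * π.π₁ (E.toHilbertModule ξ) * π.π₀ a
      = star (π.π₁ (E.toHilbertModule ξ)) * π.π₁ (E.toHilbertModule ξ) := by
    rw [h2, ← map_mul, h1]
  -- By the C⋆-identity it suffices that `x⋆ x = 0` for the difference `x` of the two sides.
  rw [← sub_eq_zero, ← CStarRing.star_mul_self_eq_zero_iff, star_sub, star_mul, sub_mul, mul_sub,
    mul_sub, mul_assoc, ← mul_assoc (star (π.π₁ _)), h3, mul_assoc, sub_self,
    sub_self, sub_zero]

theorem π₀_mul_π₁_eq_zero {ξ : E.EdgeFun} {a : C₀(V, ℂ)} (h : ∀ e ∈ tsupport ξ, a (E.r e) = 0) :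
    π.π₀ a * π.π₁ (E.toHilbertModule ξ) = 0 := by
  rw [π.π₀_mul_π₁, leftAction, ContinuousLinearMap.comp_apply, multiplication_toHilbertModule]
  have : E.edgeMulFun (pullback ⟨E.r, E.continuous_r⟩ a) ξ = 0 := by
    ext e
    rw [edgeMulFun_apply, pullback_apply, EdgeFun.zero_apply]
    by_cases he : e ∈ tsupport ξ
    · rw [ContinuousMap.coe_mk, h e he, zero_mul]
    · rw [image_eq_zero_of_notMem_tsupport he, mul_zero]
  rw [this, map_zero, map_zero]

/-- If no edge in the support of `ξ` can be followed by one in the support of `η`, then a function of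
the vertices separates `π¹(ξ)` from `π¹(η)`. -/
theorem exists_separating {ξ η : E.EdgeFun}
    (h : ∀ e ∈ tsupport ξ, ∀ f ∈ tsupport η, E.s e ≠ E.r f) :
    ∃ a : C₀(V, ℂ), π.π₁ (E.toHilbertModule ξ) * π.π₀ a = π.π₁ (E.toHilbertModule ξ) ∧
      π.π₀ a * π.π₁ (E.toHilbertModule η) = 0 := by
  obtain ⟨g, h1, h0, hg, -⟩ := exists_continuous_one_zero_of_isCompact
    (ξ.hasCompactSupport.isCompact.image E.isLocalHomeomorph_s.continuous)
    (η.hasCompactSupport.isCompact.image E.continuous_r).isClosed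
    (Set.disjoint_left.2 fun v ⟨e, he, hev⟩ ⟨f, hf, hfv⟩ => h e he f hf (hev.trans hfv.symm))
  let a : C₀(V, ℂ) := ⟨⟨fun v => (g v : ℂ), by fun_prop⟩,
    (hg.comp_left (g := fun y : ℝ => (y : ℂ)) (by simp)).is_zero_at_infty⟩
  have ha : ∀ v, a v = (g v : ℂ) := fun _ => rfl
  refine ⟨a, π.π₁_mul_π₀_eq_self fun e he => ?_, π.π₀_mul_π₁_eq_zero fun e he => ?_⟩
  · rw [ha, h1 ⟨e, he, rfl⟩]; simp
  · rw [ha, h0 ⟨e, he, rfl⟩]; simp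

end ToeplitzRep

theorem EdgeFun.sum_apply {ι : Type*} (t : Finset ι) (ξ : ι → E.EdgeFun) (e : W) :
    (∑ j ∈ t, ξ j) e = ∑ j ∈ t, ξ j e := by
  classical
  induction t using Finset.induction_on with
  | empty => simp
  | insert j t hj ih => rw [Finset.sum_insert hj, Finset.sum_insert hj, EdgeFun.add_apply, ih]

theorem EdgeFun.exists_eq_sum {m : ℕ} {U : Fin m → Set W} (hU : ∀ j, IsOpen (U j)) {K : Set W}
    (hK : IsCompact K) (hKU : K ⊆ ⋃ j, U j) (ξ : E.EdgeFun) (hξ : tsupport ξ ⊆ K) :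
    ∃ ζ : Fin m → E.EdgeFun, ξ = ∑ j, ζ j ∧ ∀ j, tsupport (ζ j) ⊆ K ∩ U j := by
  obtain ⟨f, h1, h2, h3, -⟩ := exists_continuous_sum_one_of_isOpen_isCompact hU hK hKU
  let b : Fin m → (W →ᵇ ℂ) := fun j => BoundedContinuousFunction.ofNormedAddCommGroup
    (fun e => (f j e : ℂ)) (by fun_prop) 1 (fun e => by
      rw [Complex.norm_real, Real.norm_eq_abs, abs_of_nonneg (h3 j e).1]; exact (h3 j e).2)
  have hb : ∀ j e, E.edgeMulFun (b j) ξ e = (f j e : ℂ) * ξ e := fun _ _ => rfl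
  refine ⟨fun j => E.edgeMulFun (b j) ξ, ?_, fun j => Set.subset_inter ?_ ?_⟩
  · ext e
    simp only [EdgeFun.sum_apply, hb]
    rw [← Finset.sum_mul, ← Complex.ofReal_sum]
    by_cases he : e ∈ tsupport ξ
    · have := h2 (hξ he)
      simp only [Finset.sum_apply, Pi.one_apply] at this
      rw [this]; simp
    · rw [image_eq_zero_of_notMem_tsupport he, mul_zero]
  · refine (closure_mono fun e he => ?_).trans hξ
    exact right_ne_zero_of_mul (a := (f j e : ℂ)) (he : E.edgeMulFun (b j) ξ e ≠ 0)
  · refine (closure_mono fun e he => ?_).trans (h1 j)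
    have := left_ne_zero_of_mul (a := (f j e : ℂ)) (he : E.edgeMulFun (b j) ξ e ≠ 0)
    simpa using this

/-- The extension of a linear functional to the unitization which vanishes on the unit. -/
def unitizationExtension (τ : A →L[ℂ] ℂ) : Unitization ℂ A →ₗ[ℂ] ℂ :=
  (τ : A →ₗ[ℂ] ℂ) ∘ₗ Unitization.sndHom ℂ ℂ A

@[simp] theorem unitizationExtension_apply (τ : A →L[ℂ] ℂ) (x : Unitization ℂ A) :
    unitizationExtension τ x = τ x.snd := rfl

theorem unitizationExtension_mul_comm {τ : A →L[ℂ] ℂ} (hτ : ∀ x y, τ (x * y) = τ (y * x))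
    (x y : Unitization ℂ A) :
    unitizationExtension τ (x * y) = unitizationExtension τ (y * x) := by
  simp only [unitizationExtension_apply, Unitization.snd_mul, map_add, hτ x.snd y.snd]
  rw [add_comm (τ (x.fst • y.snd))]

/-- `π¹`, with values in the unitization. -/
def ToeplitzRep.unitπ₁ : E.HilbertModule →ₗ[ℂ] Unitization ℂ A :=
  Unitization.inrHom ℂ ℂ A ∘ₗ π.π₁

@[simp] theorem ToeplitzRep.unitπ₁_apply (ξ : E.HilbertModule) :
    π.unitπ₁ ξ = (π.π₁ ξ : Unitization ℂ A) := rfl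

theorem ToeplitzRep.continuous_unitπ₁ : Continuous π.unitπ₁ :=
  AddMonoidHomClass.continuous_of_bound π.unitπ₁ 1 fun ξ => by
    rw [one_mul, unitπ₁_apply, Unitization.norm_inr]
    exact π.norm_π₁_le ξ

/-- A partition of unity reduces this to functions with small supports, for which two cyclically
adjacent factors are separated by a function of the vertices. -/
theorem trace_prod_edgeFun_eq_zero (hE : ¬ ∃ α : List W, E.IsCycle α) {τ : A →L[ℂ] ℂ}
    (hτ : ∀ x y, τ (x * y) = τ (y * x)) {n : ℕ} (ξ : Fin (n + 1) → E.EdgeFun) :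
    unitizationExtension τ (List.ofFn fun i => π.unitπ₁ (E.toHilbertModule (ξ i))).prod = 0 := by
  obtain ⟨m, U, hU, hKU, hsep⟩ := exists_finite_cover_of_forall_exists_ne
    E.isLocalHomeomorph_s.continuous E.continuous_r (n := n) (exists_source_ne_range hE)
    (isCompact_iUnion fun i => (ξ i).hasCompactSupport.isCompact)
  choose ζ hζ hζU using fun i => (ξ i).exists_eq_sum hU
    (isCompact_iUnion fun i => (ξ i).hasCompactSupport.isCompact) hKU
    (Set.subset_iUnion (fun i => tsupport (ξ i)) i)
  have hexp := (MultilinearMap.mkPiAlgebraFin ℂ (n + 1) (Unitization ℂ A)).map_sum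
    fun i (j : Fin m) => π.unitπ₁ (E.toHilbertModule (ζ i j))
  simp only [MultilinearMap.mkPiAlgebraFin_apply, ← map_sum, ← hζ] at hexp
  rw [hexp, map_sum]
  refine Finset.sum_eq_zero fun c _ => ?_
  obtain ⟨i, hi⟩ := hsep c
  obtain ⟨a, ha, ha'⟩ := π.exists_separating (ξ := ζ i (c i)) (η := ζ (i + 1) (c (i + 1)))
    fun e he f hf => hi e (hζU _ _ he) f (hζU _ _ hf)
  refine trace_prod_eq_zero (unitizationExtension_mul_comm hτ) _ (c := (π.π₀ a : Unitization ℂ A))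
    (i := i) ?_ ?_
  · rw [ToeplitzRep.unitπ₁_apply, ← Unitization.inr_mul, ha]
  · rw [ToeplitzRep.unitπ₁_apply, ← Unitization.inr_mul, ha', Unitization.inr_zero]

theorem trace_prod_π₁_eq_zero (hE : ¬ ∃ α : List W, E.IsCycle α) {τ : A →L[ℂ] ℂ}
    (hτ : ∀ x y, τ (x * y) = τ (y * x)) {n : ℕ} (ξ : Fin (n + 1) → E.HilbertModule) :
    unitizationExtension τ (List.ofFn fun i => π.unitπ₁ (ξ i)).prod = 0 := by
  have hc : Continuous fun ξ : Fin (n + 1) → E.HilbertModule =>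
      unitizationExtension τ (List.ofFn fun i => π.unitπ₁ (ξ i)).prod := by
    refine (τ.continuous.comp Unitization.continuous_snd).comp ?_
    simp only [List.ofFn_eq_map]
    exact continuous_list_prod _ fun i _ => π.continuous_unitπ₁.comp (continuous_apply i)
  refine congrFun ((DenseRange.piMap fun _ => E.denseRange_toHilbertModule).equalizer hc
    continuous_const (funext fun ξ => ?_)) ξ
  exact trace_prod_edgeFun_eq_zero π hE hτ ξ

/-! ### Words in the generators -/

variable (E) in
/-- The generators of `C⋆(E)` and their adjoints: `coef a` stands for `π⁰(a)`, `creation ξ` for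
`π¹(ξ)` and `annihilation ξ` for `π¹(ξ)⋆`. -/
inductive Letter : Type (max u v)
  | coef (a : C₀(V, ℂ))
  | creation (ξ : E.HilbertModule)
  | annihilation (ξ : E.HilbertModule)

namespace Letter

/-- The value of a letter in a Toeplitz representation. -/
def eval : E.Letter → A
  | coef a => π.π₀ a
  | creation ξ => π.π₁ ξ
  | annihilation ξ => star (π.π₁ ξ)

/-- The degree of a letter with respect to the gauge action. -/
def degree : E.Letter → ℤ
  | coef _ => 0
  | creation _ => 1
  | annihilation _ => -1

/-- The letter whose value is the adjoint. -/
def adj : E.Letter → E.Letter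
  | coef a => coef (star a)
  | creation ξ => annihilation ξ
  | annihilation ξ => creation ξ

theorem eval_adj (x : E.Letter) : x.adj.eval π = star (x.eval π) := by
  cases x <;> simp [adj, eval, map_star]

theorem degree_adj (x : E.Letter) : x.adj.degree = -x.degree := by
  cases x <;> simp [adj, degree]

/-- A letter followed by a creation operator is a single letter, unless it is itself a creation
operator. -/
theorem exists_eval_eq_mul (x y : E.Letter) (hx : x.degree ≠ 1) (hy : y.degree = 1) :
    ∃ z : E.Letter, z.eval π = x.eval π * y.eval π ∧ z.degree = x.degree + y.degree := by
  cases y with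
  | creation ξ =>
    cases x with
    | coef a => exact ⟨creation (E.leftAction a ξ), (π.π₀_mul_π₁ a ξ).symm, rfl⟩
    | creation η => exact absurd rfl hx
    | annihilation η => exact ⟨coef (E.innerL η ξ), (π.star_π₁_mul_π₁ η ξ).symm, rfl⟩
  | _ => simp [degree] at hy

theorem eq_creation {x : E.Letter} (hx : x.degree = 1) : ∃ ξ, x = creation ξ := by
  cases x with
  | creation ξ => exact ⟨ξ, rfl⟩
  | _ => simp [degree] at hx

end Letter

/-- The value of a word in the unitization. -/
def evalWord (w : List E.Letter) : Unitization ℂ A :=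
  (w.map fun x => ((x.eval π : A) : Unitization ℂ A)).prod

/-- The degree of a word with respect to the gauge action. -/
def wordDegree (w : List E.Letter) : ℤ := (w.map Letter.degree).sum

theorem evalWord_cons (x : E.Letter) (w : List E.Letter) :
    evalWord π (x :: w) = ((x.eval π : A) : Unitization ℂ A) * evalWord π w := by
  simp [evalWord]

theorem evalWord_append (w w' : List E.Letter) :
    evalWord π (w ++ w') = evalWord π w * evalWord π w' := by
  simp [evalWord]

theorem wordDegree_cons (x : E.Letter) (w : List E.Letter) :
    wordDegree (x :: w) = x.degree + wordDegree w := by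
  simp [wordDegree]

theorem wordDegree_append (w w' : List E.Letter) :
    wordDegree (w ++ w') = wordDegree w + wordDegree w' := by
  simp [wordDegree]

theorem wordDegree_nil : wordDegree ([] : List E.Letter) = 0 := rfl

theorem star_evalWord (w : List E.Letter) :
    star (evalWord π w) = evalWord π (w.reverse.map Letter.adj) := by
  induction w with
  | nil => simp [evalWord]
  | cons x w ih =>
    rw [evalWord_cons, star_mul, ih, List.reverse_cons, List.map_append, evalWord_append,
      ← Unitization.inr_star, ← Letter.eval_adj]
    simp [evalWord]

theorem wordDegree_reverse_map_adj (w : List E.Letter) :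
    wordDegree (w.reverse.map Letter.adj) = -wordDegree w := by
  induction w with
  | nil => simp [wordDegree]
  | cons x w ih =>
    rw [List.reverse_cons, List.map_append, wordDegree_append, ih, wordDegree_cons]
    simp [wordDegree, Letter.degree_adj]

/-- If the first letter of a word is not a creation operator but some letter is, then some creation
operator comes right after a letter of another kind. -/
theorem exists_append_cons_cons (x : E.Letter) (hx : x.degree ≠ 1) (w : List E.Letter)
    (hw : ∃ y ∈ w, y.degree = 1) :
    ∃ (p : List E.Letter) (a b : E.Letter) (q : List E.Letter),
      x :: w = p ++ a :: b :: q ∧ a.degree ≠ 1 ∧ b.degree = 1 := by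
  induction w generalizing x with
  | nil => simp at hw
  | cons y w ih =>
    by_cases hy : y.degree = 1
    · exact ⟨[], x, y, w, rfl, hx, hy⟩
    · obtain ⟨p, a, b, q, h, ha, hb⟩ := ih y hy (by simpa [hy] using hw)
      exact ⟨x :: p, a, b, q, by rw [h, List.cons_append], ha, hb⟩

theorem exists_degree_eq_one {w : List E.Letter} (hw : 0 < wordDegree w) :
    ∃ y ∈ w, y.degree = 1 := by
  contrapose! hw
  induction w with
  | nil => exact wordDegree_nil.le
  | cons x w ih =>
    rw [List.forall_mem_cons] at hw
    have h1 := ih hw.2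
    have h2 : x.degree ≤ 0 := by
      have := hw.1
      cases x <;> simp_all [Letter.degree]
    rw [wordDegree_cons]
    omega

/-- As long as the word contains a letter other than a creation operator, a cyclic rotation brings
such a letter in front of a creation operator, and the two merge into one letter. In the end only
creation operators are left. -/
theorem trace_evalWord_eq_zero_of_pos (hE : ¬ ∃ α : List W, E.IsCycle α) {τ : A →L[ℂ] ℂ}
    (hτ : ∀ x y, τ (x * y) = τ (y * x)) (w : List E.Letter) (hw : 0 < wordDegree w) :
    unitizationExtension τ (evalWord π w) = 0 := by
  induction hl : w.length using Nat.strong_induction_on generalizing w with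
  | _ l ih =>
    subst hl
    by_cases hall : ∀ x ∈ w, x.degree = 1
    · have h1 : ∃ v : List E.HilbertModule, w = v.map Letter.creation := by
        clear ih hw
        induction w with
        | nil => exact ⟨[], rfl⟩
        | cons x w ih' =>
          obtain ⟨v, rfl⟩ := ih' fun y hy => hall y (List.mem_cons_of_mem _ hy)
          obtain ⟨ξ, rfl⟩ := Letter.eq_creation (hall x List.mem_cons_self)
          exact ⟨ξ :: v, rfl⟩
      obtain ⟨v, rfl⟩ := h1
      rcases v with - | ⟨ξ, v⟩
      · simp [wordDegree] at hw
      · have h2 := trace_prod_π₁_eq_zero π hE hτ fun i : Fin (v.length + 1) => (ξ :: v).get i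
        rw [← Function.comp_def π.unitπ₁, ← List.map_ofFn,
          show List.ofFn (fun i : Fin (v.length + 1) => (ξ :: v).get i) = ξ :: v from
            List.ofFn_get (ξ :: v)] at h2
        rw [evalWord, List.map_map]
        exact h2
    · push Not at hall
      obtain ⟨x, hx, hx1⟩ := hall
      obtain ⟨w₁, w₂, rfl⟩ := List.append_of_mem hx
      obtain ⟨y, hy, hy1⟩ := exists_degree_eq_one hw
      obtain ⟨p, a, b, q, h, ha, hb⟩ := exists_append_cons_cons x hx1 (w₂ ++ w₁) ⟨y, by
        have : y ≠ x := fun h => hx1 (h ▸ hy1)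
        simp only [List.mem_append, List.mem_cons, this, false_or] at hy ⊢
        exact hy.symm, hy1⟩
      obtain ⟨c, hc, hcd⟩ := Letter.exists_eval_eq_mul π a b ha hb
      have heval : unitizationExtension τ (evalWord π (w₁ ++ x :: w₂))
          = unitizationExtension τ (evalWord π (p ++ c :: q)) := by
        rw [evalWord_append, unitizationExtension_mul_comm hτ, ← evalWord_append,
          List.cons_append, h, evalWord_append, evalWord_append, evalWord_cons, evalWord_cons,
          evalWord_cons, hc, Unitization.inr_mul, mul_assoc]
      have hdeg : wordDegree (w₁ ++ x :: w₂) = wordDegree (p ++ c :: q) := by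
        rw [wordDegree_append, add_comm, ← wordDegree_append, List.cons_append, h,
          wordDegree_append, wordDegree_append, wordDegree_cons, wordDegree_cons, wordDegree_cons,
          hcd, add_assoc]
      have hlen := congrArg List.length h
      rw [heval]
      refine ih _ ?_ _ (hdeg ▸ hw) rfl
      simp only [List.length_append, List.length_cons] at hlen ⊢
      omega

theorem trace_evalWord_eq_zero (hE : ¬ ∃ α : List W, E.IsCycle α) {τ : A →L[ℂ] ℂ}
    (hτ : ∀ x y, τ (x * y) = τ (y * x)) (w : List E.Letter) (hw : wordDegree w ≠ 0) :
    unitizationExtension τ (evalWord π w) = 0 := by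
  rcases hw.lt_or_gt with hw | hw
  -- The functional `x ↦ conj (τ (star x))` is a trace as well, and adjoints have positive degree.
  · let τ' : A →L[ℂ] ℂ :=
      { toFun := fun x => star (τ (star x))
        map_add' := fun x y => by simp
        map_smul' := fun c x => by simp
        cont := by fun_prop }
    have hτ' : ∀ x y, τ' (x * y) = τ' (y * x) := fun x y => by
      change star (τ (star (x * y))) = star (τ (star (y * x)))
      rw [star_mul, star_mul, hτ]
    have h := trace_evalWord_eq_zero_of_pos π hE hτ' (w.reverse.map Letter.adj)
      (by rw [wordDegree_reverse_map_adj]; omega)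
    rw [← star_evalWord, unitizationExtension_apply, Unitization.snd_star] at h
    change star (τ (star (star _))) = 0 at h
    rwa [star_star, star_eq_zero] at h
  · exact trace_evalWord_eq_zero_of_pos π hE hτ w hw

/-! ### Gauge invariance -/

variable (E)

theorem continuous_gauge (z : Circle) : Continuous (E.gauge z) :=
  AddMonoidHomClass.continuous_of_bound (E.gauge z) 1
    (fun x => by simpa using NonUnitalStarAlgHom.norm_apply_le (E.gauge z) x)

theorem gauge_eval (z : Circle) (x : E.Letter) :
    E.gauge z (x.eval E.universalRep) = (z : ℂ) ^ x.degree • x.eval E.universalRep := by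
  cases x with
  | coef a => simp [Letter.eval, Letter.degree]
  | creation ξ => simp [Letter.eval, Letter.degree]
  | annihilation ξ =>
    simp [Letter.eval, Letter.degree, map_star, ← Circle.coe_inv_eq_conj]

/-- Words are eigenvectors of the gauge action. -/
theorem gauge_snd_evalWord (z : Circle) (w : List E.Letter) :
    E.gauge z (evalWord E.universalRep w).snd
      = (z : ℂ) ^ wordDegree w • (evalWord E.universalRep w).snd := by
  have h : Unitization.starMap (E.gauge z) (evalWord E.universalRep w)
      = (z : ℂ) ^ wordDegree w • evalWord E.universalRep w := by
    induction w with
    | nil => simp [evalWord, wordDegree]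
    | cons x w ih =>
      rw [evalWord_cons, map_mul, ih, Unitization.starMap_inr, gauge_eval, Unitization.inr_smul,
        smul_mul_smul_comm, wordDegree_cons, zpow_add₀ (Circle.coe_ne_zero z)]
  have h' := congrArg (fun y => y.snd) h
  rw [Unitization.snd_smul] at h'
  rw [← h']
  simp [Unitization.algebraMap_eq_inl]

theorem exists_evalWord_eq_of_mem_closure {x : E.RepProduct}
    (hx : x ∈ Subsemigroup.closure ((Set.range E.sumπ₀ ∪ Set.range E.sumπ₁)
      ∪ star (Set.range E.sumπ₀ ∪ Set.range E.sumπ₁))) :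
    ∃ (w : List E.Letter) (y : E.GraphAlgebra),
      evalWord E.universalRep w = (y : Unitization ℂ E.GraphAlgebra) ∧ (y : E.RepProduct) = x := by
  induction hx using Subsemigroup.closure_induction with
  | mem x hx =>
    have h : ∃ l : E.Letter, ((l.eval E.universalRep : E.GraphAlgebra) : E.RepProduct) = x := by
      rcases hx with (⟨a, rfl⟩ | ⟨ξ, rfl⟩) | (⟨a, ha⟩ | ⟨ξ, hξ⟩)
      · exact ⟨.coef a, rfl⟩
      · exact ⟨.creation ξ, rfl⟩
      · exact ⟨.coef (star a), by
          rw [← star_star x, ← ha]; exact map_star E.sumπ₀ a⟩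
      · exact ⟨.annihilation ξ, by rw [← star_star x, ← hξ]; rfl⟩
    obtain ⟨l, hl⟩ := h
    exact ⟨[l], l.eval E.universalRep, by simp [evalWord], hl⟩
  | mul x x' _ _ ih ih' =>
    obtain ⟨w, y, hw, rfl⟩ := ih
    obtain ⟨w', y', hw', rfl⟩ := ih'
    exact ⟨w ++ w', y * y', by rw [evalWord_append, hw, hw', Unitization.inr_mul], rfl⟩

/-- A closed subspace of `C⋆(E)` which contains all words is everything. -/
theorem eq_top_of_forall_evalWord_mem {P : Submodule ℂ E.GraphAlgebra}
    (hP : IsClosed (P : Set E.GraphAlgebra))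
    (h : ∀ w, (evalWord E.universalRep w).snd ∈ P) : P = ⊤ := by
  let S : Submodule ℂ E.RepProduct := P.map E.cstarSubalgebra.toSubmodule.subtype
  have hS : IsClosed (S : Set E.RepProduct) :=
    E.isClosed_cstarSubalgebra.isClosedEmbedding_subtypeVal.isClosedMap _ hP
  have hle : (NonUnitalStarAlgebra.adjoin ℂ
      (Set.range E.sumπ₀ ∪ Set.range E.sumπ₁)).toSubmodule ≤ S := by
    rw [NonUnitalStarAlgebra.adjoin_eq_span, Submodule.span_le]
    intro x hx
    obtain ⟨w, y, hw, rfl⟩ := E.exists_evalWord_eq_of_mem_closure hx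
    refine ⟨y, ?_, rfl⟩
    have := h w
    rwa [hw, Unitization.snd_inr] at this
  refine (Submodule.eq_top_iff').2 fun x => ?_
  obtain ⟨y, hy, hyx⟩ := closure_minimal (show (_ : Set E.RepProduct) ⊆ S from hle) hS x.2
  rwa [← Subtype.ext hyx]

end TopologicalGraph

end

theorem mainTheorem2 {V : Type u} {W : Type v}
    [TopologicalSpace V] [LocallyCompactSpace V] [T2Space V]
    [TopologicalSpace W] [LocallyCompactSpace W] [T2Space W]
    (E : TopologicalGraph V W) (hE : ¬ ∃ α : List W, E.IsCycle α)
    (τ : E.GraphAlgebra →L[ℂ] ℂ) (hτ : IsTracialState τ) (z : Circle) (x : E.GraphAlgebra) :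
    τ (E.gauge z x) = τ x := by
  let P : Submodule ℂ E.GraphAlgebra := LinearMap.ker
    ((τ : E.GraphAlgebra →ₗ[ℂ] ℂ) ∘ₗ (E.gauge z : E.GraphAlgebra →ₗ[ℂ] E.GraphAlgebra)
      - (τ : E.GraphAlgebra →ₗ[ℂ] ℂ))
  have hmem : ∀ y, y ∈ P ↔ τ (E.gauge z y) - τ y = 0 := fun y => Iff.rfl
  have hP : P = ⊤ := by
    refine E.eq_top_of_forall_evalWord_mem ?_ fun w => ?_
    · exact isClosed_eq ((τ.continuous.comp (E.continuous_gauge z)).sub τ.continuous)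
        continuous_const
    · rw [hmem, TopologicalGraph.gauge_snd_evalWord, map_smul]
      by_cases hw : TopologicalGraph.wordDegree w = 0
      · simp [hw]
      · have h := TopologicalGraph.trace_evalWord_eq_zero E.universalRep hE hτ.trace w hw
        rw [TopologicalGraph.unitizationExtension_apply] at h
        simp [h]
  exact sub_eq_zero.1 ((hmem x).1 (hP ▸ Submodule.mem_top))
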